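/- Let $X$ be a real or complex Banach space, $\tau\in\mathbb R$ and $I_\tau=\{(t,s): \tau\ge t\ge s\ge 0\}$. A $C_0$-evolution system is a family $(U(t,s))_{(t,s)\in I_\tau}$ of bounded operators on $X$ with $U(t,t)=1$, $U(t,r)U(r,s)=U(t,s)$ for $0\le s\le r\le t\le\tau$, and $(t,s)\mapsto U(t,s)x$ continuous on $I_\tau$ for every $x\in X$; it is contractive if $\|U(t,s)\|\le 1$ on $I_\tau$. It has the generator family $(A_s,D(A_s))_{s\in[0,\tau]}$ if $\partial_s U(t,s)x=-U(t,s)A_sx$ for all $(t,s)\in I_\tau$ and $x\in D(A_s)$ (derivative within $[0,t]$). Products of unbounded operators have their natural domain $D(AB)=\{x\in D(B): Bx\in D(A)\}$. Let $V$ be a contractive $C_0$-evolution system with generator family $(L_t,D(L_t))_{t\in[0,\tau]}$. Let $M$ be a bounded operator with $\|M\|\le1$ and $P$ a bounded projection such that, for some $\delta\in(0,1)$, $\|M^n-P\|\le\delta^n$ for all $n\ge1$. Assume that, for some $b\ge0$ and all $(t,s)\in I_\tau$, $$\|PV(t,s)(1-P)\|\le (t-s)b,\qquad \|(1-P)V(t,s)P\|\le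 (t-s)b .$$ Let $Y\subset X$ be a continuously embedded Banach space with norm $\|\cdot\|_Y$ and $PY\subset Y$. Assume that $L_tP$, $PL_tP$ and $PL_tPL_sP$ are defined on all of $Y$ and bounded from $(Y,\|\cdot\|_Y)$ to $X$, uniformly in $(t,s)\in I_\tau$. Assume that, for every $t\in[0,\tau]$, the restriction of $PL_tP$ to $Y$ is closable, with closure $A_t$, and that $PL_sPY\subset D(A_t)$ for all $(t,s)\in I_\tau$, with $A_tPL_sP$ bounded from $Y$ to $X$, uniformly in $(t,s)\in I_\tau$. Let $T$ be a contractive $C_0$-evolution system with generator family $(A_t,D(A_t))_{t\in[0,\tau]}$ that commutes with $P$. Assume that there are $\tilde c,\omega\ge0$ with $T(t,s)Y\subset Y$ and $\|T(t,s)\|_{Y\to Y}\le \tilde c\,e^{(t-s)\omega}$ for all $(t,s)\in I_\tau$. Then there are $c_1,c_2\ge0$ such that, for all $t\in[0,\tau]$, all $n\ge1$ and all $x\in Y$, with $s_j=jt/n$ and the product taken in decreasing order of $j$ from left to right, $$\Bigl\|\prod_{j=1}^n MV(s_j,s_{j-1})x-T(t,0)Px\Bigr\|_X\le\Bigl(\delta^n+\frac{c_1(t+t^2)}{n}\Bigr)\|x\|_X+c_2\,\frac{t^2}{n}\,e^{t\omega}\,\|Px\|_Y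 .$$ -/

import Mathlib

open Set

noncomputable section

/-- The time triangle `I_τ = {(t, s) | τ ≥ t ≥ s ≥ 0}`. -/
def timeTriangle (τ : ℝ) : Set (ℝ × ℝ) :=
  {p | 0 ≤ p.2 ∧ p.2 ≤ p.1 ∧ p.1 ≤ τ}

section Operators

variable {𝕜 X Y : Type*} [RCLike 𝕜] [NormedAddCommGroup X] [NormedSpace 𝕜 X]
  [NormedAddCommGroup Y] [NormedSpace 𝕜 Y]

/-- A bounded operator, seen as an (everywhere defined) unbounded operator. -/
def boundedOp (B : X →L[𝕜] X) : X →ₗ.[𝕜] X :=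
  (B : X →ₗ[𝕜] X).toPMap ⊤

/-- The product `AB` of two unbounded operators, with domain `B⁻¹(D(A))`, that is,
`{x ∈ D(B) | B x ∈ D(A)}`. -/
def opMul (A B : X →ₗ.[𝕜] X) : X →ₗ.[𝕜] X where
  domain :=
    { carrier := {x | ∃ h : x ∈ B.domain, B ⟨x, h⟩ ∈ A.domain}
      zero_mem' := by
        refine ⟨B.domain.zero_mem, ?_⟩
        have h : B ⟨0, B.domain.zero_mem⟩ = 0 := B.map_zero
        rw [h]
        exact A.domain.zero_mem
      add_mem' := by
        rintro x y ⟨hx, hx'⟩ ⟨hy, hy'⟩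
        refine ⟨B.domain.add_mem hx hy, ?_⟩
        have h : B ⟨x + y, B.domain.add_mem hx hy⟩ = B ⟨x, hx⟩ + B ⟨y, hy⟩ :=
          B.map_add ⟨x, hx⟩ ⟨y, hy⟩
        rw [h]
        exact A.domain.add_mem hx' hy'
      smul_mem' := by
        rintro c x ⟨hx, hx'⟩
        refine ⟨B.domain.smul_mem c hx, ?_⟩
        have h : B ⟨c • x, B.domain.smul_mem c hx⟩ = c • B ⟨x, hx⟩ := B.map_smul c ⟨x, hx⟩
        rw [h]
        exact A.domain.smul_mem c hx' }
  toFun :=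
    { toFun := fun x => A ⟨B ⟨x.1, x.2.1⟩, x.2.2⟩
      map_add' := by
        rintro ⟨x, hx, hx'⟩ ⟨y, hy, hy'⟩
        rw [← A.map_add]
        congr 1
        exact Subtype.ext (B.map_add ⟨x, hx⟩ ⟨y, hy⟩)
      map_smul' := by
        rintro c ⟨x, hx, hx'⟩
        rw [RingHom.id_apply, ← A.map_smul]
        congr 1
        exact Subtype.ext (B.map_smul c ⟨x, hx⟩) }

theorem mem_opMul_domain {A B : X →ₗ.[𝕜] X} {x : X} :
    x ∈ (opMul A B).domain ↔ ∃ h : x ∈ B.domain, B ⟨x, h⟩ ∈ A.domain :=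
  Iff.rfl

theorem opMul_apply {A B : X →ₗ.[𝕜] X} (x : (opMul A B).domain) :
    opMul A B x = A ⟨B ⟨x.1, x.2.1⟩, x.2.2⟩ :=
  rfl

/-- For a subspace `Y` of `X` with its own norm, embedded by `ι`: the operator `A` is well defined
on `Y`, and `‖A y‖_X ≤ a ‖y‖_Y` for all `y ∈ Y`. -/
def RelBoundedBy (ι : Y →L[𝕜] X) (A : X →ₗ.[𝕜] X) (a : ℝ) : Prop :=
  ∀ y : Y, ∃ h : ι y ∈ A.domain, ‖A ⟨ι y, h⟩‖ ≤ a * ‖y‖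

/-- The operator `P A P`. -/
def compress (P : X →L[𝕜] X) (A : X →ₗ.[𝕜] X) : X →ₗ.[𝕜] X :=
  opMul (boundedOp P) (opMul A (boundedOp P))

/-- The operator `(P A P, Y)`: the restriction of `P A P` to the embedded subspace `Y`. -/
def compressOn (ι : Y →L[𝕜] X) (P : X →L[𝕜] X) (A : X →ₗ.[𝕜] X) : X →ₗ.[𝕜] X :=
  (compress P A).domRestrict (LinearMap.range (ι : Y →ₗ[𝕜] X))

end Operators

section Evolution

variable {𝕜 X Y : Type*} [RCLike 𝕜] [NormedAddCommGroup X] [NormedSpace 𝕜 X]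
  [NormedAddCommGroup Y] [NormedSpace 𝕜 Y]

/-- `U` is a `C₀`-evolution system on `[0, τ]`. -/
structure IsEvolutionSystem (τ : ℝ) (U : ℝ → ℝ → X →L[𝕜] X) : Prop where
  refl : ∀ t ∈ Icc 0 τ, U t t = 1
  comp : ∀ s r t, 0 ≤ s → s ≤ r → r ≤ t → t ≤ τ → U t r * U r s = U t s
  continuousOn : ∀ x : X, ContinuousOn (fun p : ℝ × ℝ => U p.1 p.2 x) (timeTriangle τ)

/-- All `U(t, s)` are contractions. -/
def IsContractive (τ : ℝ) (U : ℝ → ℝ → X →L[𝕜] X) : Prop :=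
  ∀ s t, 0 ≤ s → s ≤ t → t ≤ τ → ‖U t s‖ ≤ 1

/-- `(L_s, D(L_s))`, `0 ≤ s ≤ τ`, is a generator family of `U`: for all `0 ≤ s ≤ t ≤ τ` and all
`x ∈ D(L_s)` one has `∂/∂s U(t, s) x = - U(t, s) L_s x`, where `r ↦ U(t, r) x` is defined on `[0, t]`
and its derivatives at the end points are one-sided. -/
def HasGenerators [NormedSpace ℝ X] (τ : ℝ) (U : ℝ → ℝ → X →L[𝕜] X)
    (L : ℝ → X →ₗ.[𝕜] X) : Prop :=
  ∀ s t, 0 ≤ s → s ≤ t → t ≤ τ → ∀ x : (L s).domain,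
    HasDerivWithinAt (fun r => U t r (x : X)) (-(U t s (L s x))) (Icc 0 t) s

/-- The embedded space `Y` is invariant under all `U(t, s)`, and
`‖U(t, s)‖_{Y → Y} ≤ c e^{(t - s) ω}`. -/
def IsStableOn (τ : ℝ) (U : ℝ → ℝ → X →L[𝕜] X) (ι : Y →L[𝕜] X) (c ω : ℝ) : Prop :=
  ∀ s t, 0 ≤ s → s ≤ t → t ≤ τ → ∀ y : Y,
    ∃ z : Y, ι z = U t s (ι y) ∧ ‖z‖ ≤ c * Real.exp ((t - s) * ω) * ‖y‖

/-- The product `F (n - 1) ⋯ F 1 F 0`, in decreasing order from the left to the right. -/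
def decreasingProd (F : ℕ → X →L[𝕜] X) : ℕ → X →L[𝕜] X
  | 0 => 1
  | n + 1 => F n * decreasingProd F n

/-- The product of the `M V(s_j, s_{j-1})`, `j = n, …, 1`, with `s_j = j t / n`. -/
def zenoProduct (M : X →L[𝕜] X) (V : ℝ → ℝ → X →L[𝕜] X) (t : ℝ) (n : ℕ) : X →L[𝕜] X :=
  decreasingProd (fun j => M * V (((j : ℝ) + 1) * t / n) ((j : ℝ) * t / n)) n

end Evolution

end

/-! The error splits at the product of the `P V(s_j, s_{j-1})` applied to `P x`.

Replacing `M` by `P` is algebra (`norm_decreasingProd_sub_le`). Power convergence forces `M P = P M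
= P`, so each `M` shrinks the component outside `ran P` by `δ`, while each `V` feeds it at most `β =
t b / n`. Its return to `ran P` costs another factor `β`. The geometric decay and the `n` leaks add
up to `δ ^ n + O(β) + O(n β²)`.

Replacing `P V` by `T` is consistency plus stability. For `y ∈ Y ∩ ran P`, the `r`-derivatives of `P
V(t, r) y` and `T(t, r) y` both equal `-P L_r y` up to `O(t - r)`, so the two differ by `O((t -
s)²)` (`norm_compress_apply_sub_le`). The orbit of `T` stays in `Y ∩ ran P`, and telescoping along
it (`norm_decreasingProd_apply_sub_le`) sums `n` errors of size `(t / n)²`. No bound on `L_q P L_r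
P` is assumed: its part outside `ran P` is controlled by differentiating the Zeno condition
(`HasGenerators.norm_sub_apply_le`). -/

open Filter Topology

/-! ### One-sided derivative estimates. -/

section Calculus

variable {E : Type*} [NormedAddCommGroup E] [NormedSpace ℝ E]

/-- A mean value inequality on `[a, b]` which needs no derivative at the left end point. -/
theorem norm_sub_le_of_hasDerivWithinAt_Ioc {f f' : ℝ → E} {a b C : ℝ} (hab : a ≤ b)
    (hf : ContinuousOn f (Icc a b))
    (hd : ∀ q ∈ Ioc a b, HasDerivWithinAt f (f' q) (Icc a b) q)
    (hC : ∀ q ∈ Ioc a b, ‖f' q‖ ≤ C) : ‖f a - f b‖ ≤ C * (b - a) := by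
  -- Reflecting time turns the usual mean value inequality, which omits the right end point, into
  -- one that omits the left.
  have hmaps : MapsTo (fun x : ℝ => b - x) (Icc 0 (b - a)) (Icc a b) := by
    rintro x ⟨h0, h1⟩
    exact ⟨by linarith, by linarith⟩
  have key := norm_image_sub_le_of_norm_deriv_right_le_segment
    (f := fun x => f (b - x)) (f' := fun x => -(f' (b - x))) (a := 0) (b := b - a) (C := C)
    (hf.comp (by fun_prop) hmaps) ?_ ?_ (b - a) ⟨by linarith, le_rfl⟩
  · simpa using key
  · rintro x ⟨h0, h1⟩
    have hq : b - x ∈ Ioc a b := ⟨by linarith, by linarith⟩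
    have h3 : HasDerivWithinAt (fun y : ℝ => b - y) (-1) (Icc x (b - a)) x := by
      simpa using (hasDerivWithinAt_id x (Icc x (b - a))).const_sub b
    have h4 := (hd _ hq).scomp x h3 (hmaps.mono_left (Icc_subset_Icc_left h0))
    simp only [neg_smul, one_smul] at h4
    exact h4.mono_of_mem_nhdsWithin (Icc_mem_nhdsGE h1)
  · rintro x ⟨h0, h1⟩
    rw [norm_neg]
    exact hC _ ⟨by linarith, by linarith⟩

/-- A function vanishing at `q` that grows at most linearly to the left of `q` has a bounded
left derivative there. -/
theorem norm_le_of_hasDerivWithinAt_Iio {f : ℝ → E} {d : E} {q C : ℝ}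
    (hd : HasDerivWithinAt f d (Iio q) q) (hfq : f q = 0)
    (hf : ∀ᶠ r in 𝓝[<] q, ‖f r‖ ≤ (q - r) * C) : ‖d‖ ≤ C := by
  rw [hasDerivWithinAt_iff_tendsto_slope' (by simp)] at hd
  refine le_of_tendsto hd.norm ?_
  filter_upwards [hf, self_mem_nhdsWithin] with r hr hrq
  have hpos : 0 < q - r := sub_pos.2 hrq
  rw [slope_def_module, hfq, sub_zero, norm_smul, norm_inv, Real.norm_eq_abs, abs_sub_comm,
    abs_of_pos hpos, inv_mul_le_iff₀ hpos]
  exact hr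

end Calculus

/-! ### Products of contractions: from `M` to `P`, and telescoping. -/

section PowerConvergence

variable {𝕜 X : Type*} [RCLike 𝕜] [NormedAddCommGroup X] [NormedSpace 𝕜 X]
  {M P : X →L[𝕜] X} {δ : ℝ}

theorem tendsto_pow_of_norm_pow_sub_le (hδ : δ ∈ Ioo (0 : ℝ) 1)
    (hMP : ∀ n : ℕ, 1 ≤ n → ‖M ^ n - P‖ ≤ δ ^ n) : Tendsto (fun n => M ^ n) atTop (𝓝 P) := by
  rw [tendsto_iff_norm_sub_tendsto_zero]
  refine squeeze_zero' (Eventually.of_forall fun n => norm_nonneg _) ?_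
    (tendsto_pow_atTop_nhds_zero_of_lt_one hδ.1.le hδ.2)
  filter_upwards [eventually_ge_atTop 1] with n hn using hMP n hn

theorem norm_le_one_of_tendsto_pow (hM : ‖M‖ ≤ 1)
    (h : Tendsto (fun n => M ^ n) atTop (𝓝 P)) : ‖P‖ ≤ 1 := by
  refine le_of_tendsto h.norm ?_
  filter_upwards [eventually_ge_atTop 1] with n hn
  exact (norm_pow_le' M hn).trans (pow_le_one₀ (norm_nonneg _) hM)

/-- `M * M ^ n` is a shifted sequence of powers, so it has the same limit. -/
theorem mul_eq_of_tendsto_pow (h : Tendsto (fun n => M ^ n) atTop (𝓝 P)) : M * P = P := by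
  refine tendsto_nhds_unique (h.const_mul M) ?_
  simpa only [Function.comp_def, pow_succ'] using h.comp (tendsto_add_atTop_nat 1)

theorem mul_eq_of_tendsto_pow' (h : Tendsto (fun n => M ^ n) atTop (𝓝 P)) : P * M = P := by
  refine tendsto_nhds_unique (h.mul_const M) ?_
  simpa only [Function.comp_def, pow_succ] using h.comp (tendsto_add_atTop_nat 1)

theorem norm_apply_le_of_norm_le_one {A : X →L[𝕜] X} (h : ‖A‖ ≤ 1) (x : X) : ‖A x‖ ≤ ‖x‖ := by
  simpa using A.le_of_opNorm_le h x

theorem norm_decreasingProd_le_one {F : ℕ → X →L[𝕜] X} {n : ℕ} (hF : ∀ j < n, ‖F j‖ ≤ 1)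
    (x : X) : ‖decreasingProd F n x‖ ≤ ‖x‖ := by
  induction n with
  | zero => simp [decreasingProd]
  | succ n ih =>
    exact (norm_apply_le_of_norm_le_one (hF n n.lt_succ_self) _).trans
      (ih fun j hj => hF j (hj.trans n.lt_succ_self))

variable {W : ℕ → X →L[𝕜] X} {β : ℝ} {n : ℕ}

/-- The component outside of the range of `P` decays geometrically, up to the leakage `β`. -/
theorem norm_sub_apply_decreasingProd_le (hM : ‖M‖ ≤ 1) (hP : P * P = P) (hP₁ : ‖P‖ ≤ 1)
    (hδ : δ ∈ Ioo (0 : ℝ) 1) (hMP : ‖M - P‖ ≤ δ) (hcomm : M * P = P) (hcomm' : P * M = P)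
    (hW : ∀ j < n, ‖W j‖ ≤ 1) (hβ : 0 ≤ β) (hout : ∀ j < n, ‖(1 - P) * W j * P‖ ≤ β) (x : X)
    (k : ℕ) (hk : k < n) :
    ‖decreasingProd (fun j => M * W j) (k + 1) x
        - P (decreasingProd (fun j => M * W j) (k + 1) x)‖
      ≤ (δ ^ (k + 1) + β * (1 - δ)⁻¹) * ‖x‖ := by
  have hδ' : 0 < 1 - δ := sub_pos.2 hδ.2
  -- `P M = P` turns `(1 - P) M` into `M - P`, which has norm at most `δ`.
  have hstep : ∀ j, decreasingProd (fun j => M * W j) (j + 1) x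
        - P (decreasingProd (fun j => M * W j) (j + 1) x)
      = (M - P) (W j (decreasingProd (fun j => M * W j) j x)) := by
    intro j
    have h := DFunLike.congr_fun hcomm' (W j (decreasingProd (fun j => M * W j) j x))
    simp only [mul_apply_eq_comp] at h
    simp [decreasingProd, h]
  have hMW : ∀ j < n, ‖M * W j‖ ≤ 1 := fun j hj =>
    (norm_mul_le _ _).trans (mul_le_one₀ hM (norm_nonneg _) (hW j hj))
  induction k with
  | zero =>
    rw [hstep]
    have h1 := (M - P).le_of_opNorm_le hMP (W 0 x)
    have h2 := norm_apply_le_of_norm_le_one (hW 0 hk) x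
    have h3 : 0 ≤ β * (1 - δ)⁻¹ * ‖x‖ := by positivity
    have h4 := mul_le_mul_of_nonneg_left h2 hδ.1.le
    simp only [decreasingProd, one_apply_eq_self]
    linarith
  | succ k ih =>
    have ih := ih (by omega)
    rw [hstep]
    set u := decreasingProd (fun j => M * W j) (k + 1) x
    have hu₁ : ‖u‖ ≤ ‖x‖ := norm_decreasingProd_le_one (fun j hj => hMW j (by omega)) x
    -- As `(M - P) P = 0`, only the part of `W P u` that has left `ran P` survives.
    have hsplit : (M - P) (W (k + 1) u)
        = (M - P) (W (k + 1) (u - P u)) + (M - P) (((1 - P) * W (k + 1) * P) (P u)) := by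
      have e1 : P (P u) = P u := DFunLike.congr_fun hP u
      have e2 : ∀ v, M (P v) = P v := fun v => DFunLike.congr_fun hcomm v
      have e3 : ∀ v, P (P v) = P v := fun v => DFunLike.congr_fun hP v
      simp only [mul_apply_eq_comp, sub_apply,
        one_apply_eq_self, map_sub, e1, e2, e3]
      abel
    have h1 : ‖(M - P) (W (k + 1) (u - P u))‖ ≤ δ * ‖u - P u‖ :=
      ((M - P).le_of_opNorm_le hMP _).trans
        (mul_le_mul_of_nonneg_left (norm_apply_le_of_norm_le_one (hW _ hk) _) hδ.1.le)
    have h2 : ‖(M - P) (((1 - P) * W (k + 1) * P) (P u))‖ ≤ δ * (β * ‖x‖) := by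
      refine ((M - P).le_of_opNorm_le hMP _).trans (mul_le_mul_of_nonneg_left ?_ hδ.1.le)
      refine (ContinuousLinearMap.le_of_opNorm_le _ (hout _ hk) _).trans ?_
      exact mul_le_mul_of_nonneg_left ((norm_apply_le_of_norm_le_one hP₁ u).trans hu₁) hβ
    calc ‖(M - P) (W (k + 1) u)‖
        ≤ δ * ‖u - P u‖ + δ * (β * ‖x‖) := by
          rw [hsplit]
          exact (norm_add_le _ _).trans (add_le_add h1 h2)
      _ ≤ δ * ((δ ^ (k + 1) + β * (1 - δ)⁻¹) * ‖x‖) + δ * (β * ‖x‖) := by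
          gcongr
          exact hδ.1.le
      _ = (δ ^ (k + 1 + 1) + δ * β * (1 - δ)⁻¹ * (1 + (1 - δ))) * ‖x‖ := by
          field_simp
          ring
      _ ≤ (δ ^ (k + 1 + 1) + β * (1 - δ)⁻¹) * ‖x‖ := by
          -- The recursion is `e ↦ δ (e + β)`; this inequality keeps `β / (1 - δ)` as an upper bound
          -- for its leak term.
          have : δ * (1 + (1 - δ)) ≤ 1 := by nlinarith [sq_nonneg (1 - δ)]
          have h5 : 0 ≤ β * (1 - δ)⁻¹ := by positivity
          have h6 := mul_le_mul_of_nonneg_left this h5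
          exact mul_le_mul_of_nonneg_right (by linarith) (norm_nonneg _)

/-- The difference between the products of the `M W_j` and of the `P W_j`, inside of the range of
`P`. -/
theorem norm_apply_decreasingProd_sub_le (hM : ‖M‖ ≤ 1) (hP : P * P = P) (hP₁ : ‖P‖ ≤ 1)
    (hδ : δ ∈ Ioo (0 : ℝ) 1) (hMP : ‖M - P‖ ≤ δ) (hcomm : M * P = P) (hcomm' : P * M = P)
    (hW : ∀ j < n, ‖W j‖ ≤ 1) (hβ : 0 ≤ β) (hin : ∀ j < n, ‖P * W j * (1 - P)‖ ≤ β)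
    (hout : ∀ j < n, ‖(1 - P) * W j * P‖ ≤ β) (x : X) (k : ℕ) (hk : k ≤ n) :
    ‖P (decreasingProd (fun j => M * W j) k x) - decreasingProd (fun j => P * W j) k (P x)‖
      ≤ β * (2 + ∑ j ∈ Finset.range k, (δ ^ j + β * (1 - δ)⁻¹)) * ‖x‖ := by
  have hδ' : 0 < 1 - δ := sub_pos.2 hδ.2
  have hPap : ∀ v, P (P v) = P v := fun v => DFunLike.congr_fun hP v
  have hstep : ∀ k < n, ‖P (decreasingProd (fun j => M * W j) (k + 1) x)
        - decreasingProd (fun j => P * W j) (k + 1) (P x)‖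
      ≤ ‖P (decreasingProd (fun j => M * W j) k x) - decreasingProd (fun j => P * W j) k (P x)‖
        + β * ‖decreasingProd (fun j => M * W j) k x
          - P (decreasingProd (fun j => M * W j) k x)‖ := by
    intro k hk
    set u := decreasingProd (fun j => M * W j) k x
    set v := decreasingProd (fun j => P * W j) k (P x)
    have hsplit : P (decreasingProd (fun j => M * W j) (k + 1) x)
        - decreasingProd (fun j => P * W j) (k + 1) (P x)
        = P (W k (P u - v)) + (P * W k * (1 - P)) (u - P u) := by
      have e : P (M (W k u)) = P (W k u) := DFunLike.congr_fun hcomm' (W k u)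
      change P (M (W k u)) - P (W k v) = _
      simp only [mul_apply_eq_comp, sub_apply,
        one_apply_eq_self, map_sub, e, hPap]
      abel
    rw [hsplit]
    refine (norm_add_le _ _).trans (add_le_add ?_ (ContinuousLinearMap.le_of_opNorm_le _ (hin k hk) _))
    exact (norm_apply_le_of_norm_le_one hP₁ _).trans (norm_apply_le_of_norm_le_one (hW k hk) _)
  -- Before the first factor nothing has decayed; this is the source of the summand `2`.
  have hzero : ‖x - P x‖ ≤ 2 * ‖x‖ := by
    have := norm_sub_le x (P x)
    have := norm_apply_le_of_norm_le_one hP₁ x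
    linarith
  induction k with
  | zero =>
    simp only [decreasingProd, one_apply_eq_self, sub_self, norm_zero]
    simp only [Finset.range_zero, Finset.sum_empty]
    positivity
  | succ k ih =>
    refine (hstep k hk).trans ?_
    have ih := ih (by omega)
    -- The decay estimate needs at least one factor, so the first step uses `hzero`; the `j = 0`
    -- term of the sum is then slack.
    rcases k with _ | k
    · simp only [decreasingProd, one_apply_eq_self, sub_self, norm_zero, zero_add,
        Finset.sum_range_one, pow_zero]
      have h5 : 0 ≤ β * (1 - δ)⁻¹ := by positivity
      calc β * ‖x - P x‖ ≤ β * (2 * ‖x‖) := by gcongr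
        _ ≤ β * ((2 + (1 + β * (1 - δ)⁻¹)) * ‖x‖) := by gcongr; linarith
        _ = _ := by ring
    · have h := norm_sub_apply_decreasingProd_le hM hP hP₁ hδ hMP hcomm hcomm' hW hβ hout x k
        (by omega)
      rw [Finset.sum_range_succ]
      have h' := mul_le_mul_of_nonneg_left h hβ
      linarith

/-- Replacing `M` by its limit `P` in a product of contractions which leave the range and the kernel
of `P` invariant up to `β`. -/
theorem norm_decreasingProd_sub_le (hM : ‖M‖ ≤ 1) (hP : P * P = P)
    (hδ : δ ∈ Ioo (0 : ℝ) 1) (hMP : ∀ n : ℕ, 1 ≤ n → ‖M ^ n - P‖ ≤ δ ^ n)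
    (hW : ∀ j < n, ‖W j‖ ≤ 1) (hβ : 0 ≤ β) (hin : ∀ j < n, ‖P * W j * (1 - P)‖ ≤ β)
    (hout : ∀ j < n, ‖(1 - P) * W j * P‖ ≤ β) (hn : 1 ≤ n) (x : X) :
    ‖decreasingProd (fun j => M * W j) n x - decreasingProd (fun j => P * W j) n (P x)‖
      ≤ (δ ^ n + (β * (2 + 2 * (1 - δ)⁻¹) + n * β ^ 2 * (1 - δ)⁻¹)) * ‖x‖ := by
  have hδ' : 0 < 1 - δ := sub_pos.2 hδ.2
  have hlim := tendsto_pow_of_norm_pow_sub_le hδ hMP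
  have hP₁ := norm_le_one_of_tendsto_pow hM hlim
  have hcomm := mul_eq_of_tendsto_pow hlim
  have hcomm' := mul_eq_of_tendsto_pow' hlim
  have hN : ‖M - P‖ ≤ δ := by simpa using hMP 1 le_rfl
  have h1 := norm_sub_apply_decreasingProd_le hM hP hP₁ hδ hN hcomm hcomm' hW hβ hout x (n - 1)
    (by omega)
  rw [Nat.sub_add_cancel hn] at h1
  have h2 := norm_apply_decreasingProd_sub_le hM hP hP₁ hδ hN hcomm hcomm' hW hβ hin hout x n le_rfl
  have hgeom : ∑ j ∈ Finset.range n, δ ^ j ≤ (1 - δ)⁻¹ := by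
    rw [← tsum_geometric_of_lt_one hδ.1.le hδ.2]
    exact (summable_geometric_of_lt_one hδ.1.le hδ.2).sum_le_tsum _
      fun j _ => pow_nonneg hδ.1.le j
  have h3 : β * (2 + ∑ j ∈ Finset.range n, (δ ^ j + β * (1 - δ)⁻¹)) * ‖x‖
      ≤ β * (2 + ((1 - δ)⁻¹ + n * (β * (1 - δ)⁻¹))) * ‖x‖ := by
    rw [Finset.sum_add_distrib, Finset.sum_const, Finset.card_range, nsmul_eq_mul]
    gcongr
  have h4 := norm_sub_le_norm_sub_add_norm_sub (decreasingProd (fun j => M * W j) n x)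
    (P (decreasingProd (fun j => M * W j) n x)) (decreasingProd (fun j => P * W j) n (P x))
  refine (h4.trans (add_le_add h1 (h2.trans h3))).trans (le_of_eq ?_)
  ring

/-- Telescoping: a product of contractions compared with an orbit that it follows up to an error `ε`
in each step. -/
theorem norm_decreasingProd_apply_sub_le {F : ℕ → X →L[𝕜] X} {v : ℕ → X} {ε : ℝ}
    (hF : ∀ j < n, ‖F j‖ ≤ 1) (hv : ∀ j < n, ‖F j (v j) - v (j + 1)‖ ≤ ε) :
    ‖decreasingProd F n (v 0) - v n‖ ≤ n * ε := by
  induction n with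
  | zero => simp [decreasingProd]
  | succ n ih =>
    have ih := ih (fun j hj => hF j (by omega)) (fun j hj => hv j (by omega))
    have h1 : ‖F n (decreasingProd F n (v 0)) - F n (v n)‖
        ≤ ‖decreasingProd F n (v 0) - v n‖ := by
      rw [← map_sub]
      exact norm_apply_le_of_norm_le_one (hF n n.lt_succ_self) _
    have h2 := norm_sub_le_norm_sub_add_norm_sub (F n (decreasingProd F n (v 0))) (F n (v n))
      (v (n + 1))
    have h3 := hv n n.lt_succ_self
    change ‖F n (decreasingProd F n (v 0)) - v (n + 1)‖ ≤ _
    push_cast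
    linarith

end PowerConvergence

/-! ### Consequences of the generator property. -/

section Generators

variable {𝕜 X : Type*} [RCLike 𝕜] [NormedAddCommGroup X] [NormedSpace 𝕜 X]
  {τ : ℝ} {U : ℝ → ℝ → X →L[𝕜] X} {L : ℝ → X →ₗ.[𝕜] X}

theorem IsEvolutionSystem.continuousOn_right (hU : IsEvolutionSystem τ U) {t : ℝ} (ht : t ≤ τ)
    (x : X) : ContinuousOn (fun r => U t r x) (Icc 0 t) :=
  (hU.continuousOn x).comp (f := fun r : ℝ => (t, r)) (by fun_prop)
    fun _ hr => ⟨hr.1, hr.2, ht⟩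

variable [NormedSpace ℝ X]

/-- A vector in the domains of all generators is moved at most linearly in time. -/
theorem HasGenerators.norm_apply_sub_le (hU : IsEvolutionSystem τ U) (hUc : IsContractive τ U)
    (hL : HasGenerators τ U L) {s t C : ℝ} (hs : 0 ≤ s) (hst : s ≤ t) (ht : t ≤ τ) {x : X}
    (hx : ∀ q ∈ Ioc s t, ∃ h : x ∈ (L q).domain, ‖L q ⟨x, h⟩‖ ≤ C) :
    ‖U t s x - x‖ ≤ C * (t - s) := by
  have hx' : ∀ q, ∃ d : X, q ∈ Ioc s t →
      ∃ h : x ∈ (L q).domain, d = L q ⟨x, h⟩ ∧ ‖d‖ ≤ C := by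
    intro q
    by_cases hq : q ∈ Ioc s t
    · obtain ⟨h, hC⟩ := hx q hq
      exact ⟨_, fun _ => ⟨h, rfl, hC⟩⟩
    · exact ⟨0, fun h => absurd h hq⟩
  choose d hd using hx'
  have hsub : Icc s t ⊆ Icc 0 t := Icc_subset_Icc_left hs
  have key := norm_sub_le_of_hasDerivWithinAt_Ioc (f := fun r => U t r x)
    (f' := fun q => -(U t q (d q))) (C := C) hst ((hU.continuousOn_right ht x).mono hsub) ?_ ?_
  · simpa [hU.refl t ⟨hs.trans hst, ht⟩] using key
  · intro q hq
    obtain ⟨h, hdq, -⟩ := hd q hq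
    rw [hdq]
    exact (hL q t (hs.trans hq.1.le) hq.2 ht ⟨x, h⟩).mono hsub
  · intro q hq
    obtain ⟨h, -, hC⟩ := hd q hq
    rw [norm_neg]
    exact (norm_apply_le_of_norm_le_one (hUc q t (hs.trans hq.1.le) hq.2 ht) _).trans hC

variable [IsScalarTower ℝ 𝕜 X]

theorem HasDerivWithinAt.clm_apply_const (B : X →L[𝕜] X) {f : ℝ → X} {d : X} {s : Set ℝ} {r : ℝ}
    (h : HasDerivWithinAt f d s r) : HasDerivWithinAt (fun r => B (f r)) (B d) s r :=
  (B.restrictScalars ℝ).hasFDerivAt.comp_hasDerivWithinAt r h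

/-- If the range of the projection `P` is invariant under `U` up to first order, then the generators
map it into itself up to a bounded error. -/
theorem HasGenerators.norm_sub_apply_le (hU : IsEvolutionSystem τ U) (hL : HasGenerators τ U L)
    {P : X →L[𝕜] X} {b : ℝ}
    (hout : ∀ s t, 0 ≤ s → s ≤ t → t ≤ τ → ‖(1 - P) * U t s * P‖ ≤ (t - s) * b)
    {q : ℝ} (hq : 0 < q) (hqτ : q ≤ τ) (x : (L q).domain) (hx : P x = x) :
    ‖L q x - P (L q x)‖ ≤ b * ‖(x : X)‖ := by
  have hqq := hU.refl q ⟨hq.le, hqτ⟩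
  -- Since `q > 0`, `[0, q]` is a left neighbourhood of `q`; at `q = 0` there would be no left
  -- derivative.
  have h := ((hL q q hq.le le_rfl hqτ x).clm_apply_const (1 - P)).mono_of_mem_nhdsWithin
    (Icc_mem_nhdsLT hq)
  rw [← norm_neg]
  refine norm_le_of_hasDerivWithinAt_Iio (f := fun r => (1 - P) (U q r (x : X))) (q := q) ?_ ?_ ?_
  · simpa [hqq, neg_add_eq_sub] using h
  · simp [hqq, hx]
  · filter_upwards [Icc_mem_nhdsLT hq] with r hr
    have h2 := ((1 - P) * U q r * P).le_of_opNorm_le (hout r q hr.1 hr.2 hqτ) (x : X)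
    simp only [mul_apply_eq_comp, hx] at h2
    linarith

end Generators

/-! ### Second-order agreement of `P V P` and `T`. -/

section Consistency

variable {𝕜 X Y : Type*} [RCLike 𝕜] [NormedAddCommGroup X] [NormedSpace 𝕜 X]
  [NormedAddCommGroup Y] [NormedSpace 𝕜 Y]

theorem mem_compressOn_closure_domain {ι : Y →L[𝕜] X} {P : X →L[𝕜] X} {A : X →ₗ.[𝕜] X} {y : Y}
    (h : P (ι y) ∈ A.domain) :
    ∃ h' : ι y ∈ (compressOn ι P A).closure.domain,
      (compressOn ι P A).closure ⟨ι y, h'⟩ = P (A ⟨P (ι y), h⟩) := by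
  have hc : ι y ∈ (compress P A).domain := ⟨⟨trivial, h⟩, trivial⟩
  have hr : ι y ∈ (compressOn ι P A).domain := ⟨⟨y, rfl⟩, hc⟩
  have hle := (compressOn ι P A).le_closure
  refine ⟨hle.1 hr, ?_⟩
  rw [← hle.2 (x := ⟨ι y, hr⟩) rfl]
  rfl

variable [NormedSpace ℝ X] [IsScalarTower ℝ 𝕜 X]
  {τ : ℝ} {V T : ℝ → ℝ → X →L[𝕜] X} {L : ℝ → X →ₗ.[𝕜] X} {P : X →L[𝕜] X} {ι : Y →L[𝕜] X}
  {a₁ a₂ a₃ b : ℝ}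

/-- The compressed evolution `P V P` and the evolution generated by the closures of the `P L P`
agree up to second order. -/
theorem norm_compress_apply_sub_le
    (hV : IsEvolutionSystem τ V) (hVc : IsContractive τ V) (hVL : HasGenerators τ V L)
    (hP : P * P = P) (hP₁ : ‖P‖ ≤ 1) (hb : 0 ≤ b)
    (hin : ∀ s t, 0 ≤ s → s ≤ t → t ≤ τ → ‖P * V t s * (1 - P)‖ ≤ (t - s) * b)
    (hout : ∀ s t, 0 ≤ s → s ≤ t → t ≤ τ → ‖(1 - P) * V t s * P‖ ≤ (t - s) * b)
    (hLP : ∀ t ∈ Icc 0 τ, RelBoundedBy ι (opMul (L t) (boundedOp P)) a₁)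
    (hPLP : ∀ t ∈ Icc 0 τ, RelBoundedBy ι (compress P (L t)) a₂)
    (hPLPLP : ∀ s t, 0 ≤ s → s ≤ t → t ≤ τ →
      RelBoundedBy ι (opMul (compress P (L t)) (opMul (L s) (boundedOp P))) a₃ ∧
      RelBoundedBy ι (opMul (compressOn ι P (L t)).closure (compress P (L s))) a₃)
    (hT : IsEvolutionSystem τ T) (hTc : IsContractive τ T)
    (hTL : HasGenerators τ T (fun t => (compressOn ι P (L t)).closure))
    {s t : ℝ} (hs : 0 ≤ s) (hst : s ≤ t) (ht : t ≤ τ) (y : Y) (hy : P (ι y) = ι y) :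
    ‖P (V t s (ι y)) - T t s (ι y)‖
      ≤ (b * a₁ + (a₃ + b * a₂) + a₃) * ‖y‖ * (t - s) ^ 2 := by
  have hPap : ∀ v, P (P v) = P v := fun v => DFunLike.congr_fun hP v
  -- `d r` is `L_r P y`, with junk value `0` outside `[0, τ]` so that it is a total function.
  have hdom : ∀ r, ∃ d : X, r ∈ Icc 0 τ → ∃ h : P (ι y) ∈ (L r).domain,
      d = L r ⟨P (ι y), h⟩ := by
    intro r
    by_cases hr : r ∈ Icc 0 τ
    · obtain ⟨⟨_, h⟩, _⟩ := hLP r hr y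
      exact ⟨_, fun _ => ⟨h, rfl⟩⟩
    · exact ⟨0, fun h => absurd h hr⟩
  choose d hd using hdom
  have hsub : Icc s t ⊆ Icc 0 t := Icc_subset_Icc_left hs
  have hmem : ∀ r ∈ Ioc s t, r ∈ Icc 0 τ := fun r hr => ⟨hs.trans hr.1.le, hr.2.trans ht⟩
  have htt : t ∈ Icc 0 τ := ⟨hs.trans hst, ht⟩
  have hd₁ : ∀ r ∈ Icc 0 τ, ‖d r‖ ≤ a₁ * ‖y‖ := by
    intro r hr
    obtain ⟨h, hdr⟩ := hd r hr
    obtain ⟨_, h₁⟩ := hLP r hr y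
    rw [hdr]
    exact h₁
  have hd₂ : ∀ r ∈ Icc 0 τ, ‖P (d r)‖ ≤ a₂ * ‖y‖ := by
    intro r hr
    obtain ⟨h, hdr⟩ := hd r hr
    obtain ⟨_, h₁⟩ := hPLP r hr y
    rw [hdr]
    exact h₁
  have hnorm : ∀ r ∈ Ioc s t, ‖-(P (V t r (d r)) - T t r (P (d r)))‖
      ≤ (b * a₁ + (a₃ + b * a₂) + a₃) * ‖y‖ * (t - s) := by
    intro r hr
    have hrτ := hmem r hr
    obtain ⟨h, hdr⟩ := hd r hrτ
    have hVz : ‖V t r (P (d r)) - P (d r)‖ ≤ (a₃ + b * a₂) * ‖y‖ * (t - r) := by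
      refine hVL.norm_apply_sub_le hV hVc hrτ.1 hr.2 ht fun q hq => ?_
      obtain ⟨⟨_, ⟨_, h₁⟩, _⟩, h₃⟩ := (hPLPLP r q hrτ.1 hq.1.le (hq.2.trans ht)).1 y
      have h₁ : P (d r) ∈ (L q).domain := by rw [hdr]; exact h₁
      have h₃ : ‖P (L q ⟨P (d r), h₁⟩)‖ ≤ a₃ * ‖y‖ := by
        simp only [hdr]
        exact h₃
      refine ⟨h₁, ?_⟩
      -- `P L_q P d` is bounded by hypothesis; this supplies the complementary part `(1 - P) L_q P
      -- d`.
      have h₄ := hVL.norm_sub_apply_le hV hout (hrτ.1.trans_lt hq.1) (hq.2.trans ht)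
        ⟨P (d r), h₁⟩ (hPap _)
      have h₅ := mul_le_mul_of_nonneg_left (hd₂ r hrτ) hb
      have h₆ := norm_le_norm_sub_add (L q ⟨P (d r), h₁⟩) (P (L q ⟨P (d r), h₁⟩))
      dsimp only at h₄
      linarith
    have hTz : ‖T t r (P (d r)) - P (d r)‖ ≤ a₃ * ‖y‖ * (t - r) := by
      refine hTL.norm_apply_sub_le hT hTc hrτ.1 hr.2 ht fun q hq => ?_
      obtain ⟨⟨_, h₁⟩, h₃⟩ := (hPLPLP r q hrτ.1 hq.1.le (hq.2.trans ht)).2 y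
      rw [hdr]
      exact ⟨h₁, h₃⟩
    have hleak : ‖(P * V t r * (1 - P)) (d r)‖ ≤ b * a₁ * ‖y‖ * (t - r) := by
      refine (ContinuousLinearMap.le_of_opNorm_le _ (hin r t hrτ.1 hr.2 ht) _).trans ?_
      have h₁ := mul_le_mul_of_nonneg_left (hd₁ r hrτ)
        (mul_nonneg (sub_nonneg.2 hr.2) hb)
      linarith
    have hsplit : P (V t r (d r)) - T t r (P (d r))
        = (P * V t r * (1 - P)) (d r) + P (V t r (P (d r)) - P (d r))
          - (T t r (P (d r)) - P (d r)) := by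
      simp only [mul_apply_eq_comp, sub_apply,
        one_apply_eq_self, map_sub, hPap]
      abel
    have hPV := norm_apply_le_of_norm_le_one hP₁ (V t r (P (d r)) - P (d r))
    have htri : ‖P (V t r (d r)) - T t r (P (d r))‖
        ≤ (b * a₁ + (a₃ + b * a₂) + a₃) * ‖y‖ * (t - r) := by
      rw [hsplit]
      refine (norm_sub_le _ _).trans ?_
      have := norm_add_le ((P * V t r * (1 - P)) (d r)) (P (V t r (P (d r)) - P (d r)))
      linarith
    rw [norm_neg]
    refine htri.trans ?_
    -- The constants `a₁`, `a₂`, `a₃` need not be nonnegative, but their products with `‖y‖` are,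
    -- because they bound norms.
    have hpos : 0 ≤ (b * a₁ + (a₃ + b * a₂) + a₃) * ‖y‖ := by
      have h₁ := (norm_nonneg _).trans (hd₁ t htt)
      have h₂ := (norm_nonneg _).trans (hd₂ t htt)
      obtain ⟨_, h₃⟩ := (hPLPLP t t htt.1 le_rfl ht).1 y
      have h₃ := (norm_nonneg _).trans h₃
      have h₄ := mul_nonneg hb h₁
      have h₅ := mul_nonneg hb h₂
      linarith
    exact mul_le_mul_of_nonneg_left (by linarith [hr.1]) hpos
  have key := norm_sub_le_of_hasDerivWithinAt_Ioc
    (f := fun r => P (V t r (ι y)) - T t r (ι y))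
    (f' := fun r => -(P (V t r (d r)) - T t r (P (d r)))) hst ?_ ?_ hnorm
  · have hz : P (V t t (ι y)) - T t t (ι y) = 0 := by
      simp [hV.refl t htt, hT.refl t htt, hy]
    rw [hz, sub_zero] at key
    refine key.trans (le_of_eq (by ring))
  · exact (P.continuous.comp_continuousOn ((hV.continuousOn_right ht _).mono hsub)).sub
      ((hT.continuousOn_right ht _).mono hsub)
  · intro r hr
    have hrτ := hmem r hr
    obtain ⟨h, hdr⟩ := hd r hrτ
    obtain ⟨h', hA⟩ := mem_compressOn_closure_domain (ι := ι) h
    have hv := ((hVL r t hrτ.1 hr.2 ht ⟨P (ι y), h⟩).clm_apply_const P).mono hsub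
    have hw := (hTL r t hrτ.1 hr.2 ht ⟨ι y, h'⟩).mono hsub
    rw [hA] at hw
    rw [← hdr] at hv hw
    simp only [hy] at hv
    have := hv.sub hw
    rw [map_neg, ← neg_sub'] at this
    exact this

end Consistency

/-! ### Assembly of the two estimates on the grid. -/

theorem theorem5p4 {𝕜 X Y : Type*} [RCLike 𝕜]
    [NormedAddCommGroup X] [NormedSpace 𝕜 X] [NormedSpace ℝ X] [IsScalarTower ℝ 𝕜 X]
    [CompleteSpace X]
    [NormedAddCommGroup Y] [NormedSpace 𝕜 Y] [CompleteSpace Y]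
    (τ : ℝ)
    -- the contractive evolution system `V` with generator family `L`
    (V : ℝ → ℝ → X →L[𝕜] X) (L : ℝ → X →ₗ.[𝕜] X)
    (hV : IsEvolutionSystem τ V) (hVc : IsContractive τ V) (hVL : HasGenerators τ V L)
    -- the measurement `M` and the projection `P`
    (M P : X →L[𝕜] X) (hM : ‖M‖ ≤ 1) (hP : P * P = P)
    (δ : ℝ) (hδ : δ ∈ Ioo (0 : ℝ) 1)
    (hMP : ∀ n : ℕ, 1 ≤ n → ‖M ^ n - P‖ ≤ δ ^ n)
    -- the asymptotic Zeno condition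
    (b : ℝ) (hb : 0 ≤ b)
    (hZeno₁ : ∀ s t, 0 ≤ s → s ≤ t → t ≤ τ → ‖P * V t s * (1 - P)‖ ≤ (t - s) * b)
    (hZeno₂ : ∀ s t, 0 ≤ s → s ≤ t → t ≤ τ → ‖(1 - P) * V t s * P‖ ≤ (t - s) * b)
    -- the Banach space `Y`, continuously embedded into `X` and invariant under `P`
    (ι : Y →L[𝕜] X) (hι : Function.Injective ι)
    (hPY : ∀ y : Y, ∃ z : Y, ι z = P (ι y))
    -- `L_t P`, `P L_t P`, `P L_t P L_s P` are well defined on `Y` and relatively `Y`-bounded; in the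
    -- last product `P L_t P` is also taken as the closure of `(P L_t P, Y)`
    (hLP : ∃ a : ℝ, ∀ t ∈ Icc 0 τ, RelBoundedBy ι (opMul (L t) (boundedOp P)) a)
    (hPLP : ∃ a : ℝ, ∀ t ∈ Icc 0 τ, RelBoundedBy ι (compress P (L t)) a)
    (hPLPLP : ∃ a : ℝ, ∀ s t, 0 ≤ s → s ≤ t → t ≤ τ →
      RelBoundedBy ι (opMul (compress P (L t)) (opMul (L s) (boundedOp P))) a ∧
      RelBoundedBy ι (opMul (compressOn ι P (L t)).closure (compress P (L s))) a)
    -- the contractive evolution system `T` generated by the closure of `(P L_t P, Y)`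
    (hcl : ∀ t ∈ Icc 0 τ, (compressOn ι P (L t)).IsClosable)
    (T : ℝ → ℝ → X →L[𝕜] X)
    (hT : IsEvolutionSystem τ T) (hTc : IsContractive τ T)
    (hTL : HasGenerators τ T (fun t => (compressOn ι P (L t)).closure))
    (hTP : ∀ s t, 0 ≤ s → s ≤ t → t ≤ τ → T t s * P = P * T t s)
    -- `Y` is stable under `T`
    (c ω : ℝ) (hc : 0 ≤ c) (hω : 0 ≤ ω) (hTY : IsStableOn τ T ι c ω) :
    ∃ c₁ c₂ : ℝ, 0 ≤ c₁ ∧ 0 ≤ c₂ ∧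
      ∀ t ∈ Icc 0 τ, ∀ n : ℕ, 1 ≤ n → ∀ x Px : Y, ι Px = P (ι x) →
        ‖zenoProduct M V t n (ι x) - T t 0 (P (ι x))‖ ≤
          (δ ^ n + c₁ * (t + t ^ 2) / n) * ‖ι x‖
            + c₂ * (t ^ 2 / n) * Real.exp (t * ω) * ‖Px‖ := by
  obtain ⟨a₁, hLP⟩ := hLP
  obtain ⟨a₂, hPLP⟩ := hPLP
  obtain ⟨a₃, hPLPLP⟩ := hPLPLP
  have hδ' : 0 < 1 - δ := sub_pos.2 hδ.2
  have hP₁ := norm_le_one_of_tendsto_pow hM (tendsto_pow_of_norm_pow_sub_le hδ hMP)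
  -- The absolute value covers negative `aᵢ`, possible when `Y` is trivial.
  set K := |b * a₁ + (a₃ + b * a₂) + a₃|
  -- With `β = t b / n`, the terms in `β` and `n β²` give `t / n` and `t² / n`; `c₁` adds their
  -- coefficients.
  refine ⟨b * (2 + 2 * (1 - δ)⁻¹) + b ^ 2 * (1 - δ)⁻¹, K * c, by positivity, by positivity, ?_⟩
  intro t ht n hn x Px hPx
  have hn₀ : (0 : ℝ) < n := by exact_mod_cast hn
  have hgrid : ∀ j < n, 0 ≤ (j : ℝ) * t / n ∧ (j : ℝ) * t / n ≤ ((j : ℝ) + 1) * t / n ∧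
      ((j : ℝ) + 1) * t / n ≤ t := by
    intro j hj
    have hj' : (j : ℝ) + 1 ≤ n := by exact_mod_cast hj
    have ht₀ := ht.1
    refine ⟨by positivity, by gcongr; linarith, ?_⟩
    rw [div_le_iff₀ hn₀, mul_comm t]
    gcongr
  have hstep : ∀ j : ℕ, ((j : ℝ) + 1) * t / n - (j : ℝ) * t / n = t / n := fun j => by ring
  set W : ℕ → X →L[𝕜] X := fun j => V (((j : ℝ) + 1) * t / n) ((j : ℝ) * t / n)
  have hW : ∀ j < n, ‖W j‖ ≤ 1 := fun j hj =>
    hVc _ _ (hgrid j hj).1 (hgrid j hj).2.1 ((hgrid j hj).2.2.trans ht.2)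
  have hin : ∀ j < n, ‖P * W j * (1 - P)‖ ≤ t / n * b := fun j hj => by
    rw [← hstep j]
    exact hZeno₁ _ _ (hgrid j hj).1 (hgrid j hj).2.1 ((hgrid j hj).2.2.trans ht.2)
  have hout : ∀ j < n, ‖(1 - P) * W j * P‖ ≤ t / n * b := fun j hj => by
    rw [← hstep j]
    exact hZeno₂ _ _ (hgrid j hj).1 (hgrid j hj).2.1 ((hgrid j hj).2.2.trans ht.2)
  have hβ : 0 ≤ t / n * b := mul_nonneg (div_nonneg ht.1 hn₀.le) hb
  have h1 := norm_decreasingProd_sub_le hM hP hδ hMP hW hβ hin hout hn (ι x)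
  have hPW : ∀ j < n, ‖P * W j‖ ≤ 1 := fun j hj =>
    (norm_mul_le _ _).trans (mul_le_one₀ hP₁ (norm_nonneg _) (hW j hj))
  have hlocal : ∀ j < n, ‖(P * W j) (T ((j : ℝ) * t / n) 0 (P (ι x)))
      - T (((j + 1 : ℕ) : ℝ) * t / n) 0 (P (ι x))‖
      ≤ K * (c * Real.exp (t * ω) * ‖Px‖) * (t / n) ^ 2 := by
    intro j hj
    obtain ⟨h₀, h₁, h₂⟩ := hgrid j hj
    obtain ⟨z, hz, hzn⟩ := hTY 0 ((j : ℝ) * t / n) le_rfl h₀ ((h₁.trans h₂).trans ht.2) Px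
    rw [hPx] at hz
    -- Commutation with `P` keeps the orbit in `ran P`.
    have hPz : P (ι z) = ι z := by
      have h₃ := DFunLike.congr_fun (hTP _ _ le_rfl h₀ ((h₁.trans h₂).trans ht.2)) (P (ι x))
      have h₄ : P (P (ι x)) = P (ι x) := DFunLike.congr_fun hP (ι x)
      rw [mul_apply_eq_comp, mul_apply_eq_comp, h₄] at h₃
      rw [hz, ← h₃]
    have hcomp := DFunLike.congr_fun
      (hT.comp 0 _ _ le_rfl h₀ h₁ (h₂.trans ht.2)) (P (ι x))
    rw [mul_apply_eq_comp, ← hz] at hcomp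
    rw [Nat.cast_succ, ← hcomp, ← hz, mul_apply_eq_comp]
    have h₃ := norm_compress_apply_sub_le hV hVc hVL hP hP₁ hb hZeno₁ hZeno₂ hLP hPLP hPLPLP
      hT hTc hTL h₀ h₁ (h₂.trans ht.2) z hPz
    rw [hstep] at h₃
    refine h₃.trans ?_
    have h₄ : ‖z‖ ≤ c * Real.exp (t * ω) * ‖Px‖ := by
      refine hzn.trans ?_
      have : (j : ℝ) * t / n - 0 ≤ t := by linarith
      gcongr
    gcongr
    exact le_abs_self _
  have h2 := norm_decreasingProd_apply_sub_le (v := fun j => T ((j : ℝ) * t / n) 0 (P (ι x)))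
    hPW hlocal
  have hT₀ : T 0 0 = 1 := hT.refl 0 ⟨le_rfl, ht.1.trans ht.2⟩
  simp only [Nat.cast_zero, zero_mul, zero_div, hT₀, one_apply_eq_self,
    mul_div_cancel_left₀ t hn₀.ne'] at h2
  refine (norm_sub_le_norm_sub_add_norm_sub _ _ _).trans ((add_le_add h1 h2).trans ?_)
  have hD : 0 ≤ (1 - δ)⁻¹ := by positivity
  have ht₀ := ht.1
  refine add_le_add (mul_le_mul_of_nonneg_right ?_ (norm_nonneg _)) (le_of_eq ?_)
  · rw [add_le_add_iff_left]
    have e : t / n * b * (2 + 2 * (1 - δ)⁻¹) + n * (t / n * b) ^ 2 * (1 - δ)⁻¹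
        = (b * (2 + 2 * (1 - δ)⁻¹) * t + b ^ 2 * (1 - δ)⁻¹ * t ^ 2) / n := by
      field_simp
    rw [e]
    gcongr
    -- The cross terms of `c₁ (t + t²)`, which are simply dropped.
    have p1 : 0 ≤ b * (2 + 2 * (1 - δ)⁻¹) * t ^ 2 := by positivity
    have p2 : 0 ≤ b ^ 2 * (1 - δ)⁻¹ * t := by positivity
    linarith
  · field_simp
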